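/- Let $a<0$, $b>0$, $\gamma>0$, $\ell<0$ and $\bar r\neq 0$ be real constants, and consider the scalar closed-loop reference model (CRM) adaptive system with constant reference input $\bar r$, with state $z=[x_m,e,\phi]^{\mathsf T}\in\mathbb R^3$ and plant state $x=e+x_m$: $$\dot x_m = a x_m + b\bar r-\ell e,\qquad \dot e=(a+\ell)e+b\,\phi\,x,\qquad \dot\phi=-\gamma\, e\,x .$$ Put $\bar x=-b\bar r/a$ and $\bar z=[\bar x,0,0]^{\mathsf T}$. Then $\bar z$ is the unique equilibrium of the system; for every $t_0\ge 0$ and $z_0\in\mathbb R^3$ there is a solution $t\mapsto s(t;z_0,t_0)$ on $[t_0,\infty)$ with $s(t_0;z_0,t_0)=z_0$; and $\bar z$ is uniformly asymptotically stable in the large (UASL). That is, for every choice of such solutions $s$, with $\|\cdot\|$ the Euclidean norm: (i) (uniformly stable) for every $\epsilon>0$ there is $\delta>0$ such that for all $t_0\ge0$ and all $z_0$, $\|z_0-\bar z\|\le\delta$ implies $\|s(t;z_0,t_0)-\bar z\|\le\epsilon$ for all $t\ge t_0$; (ii) (uniformly bounded) for every $R>0$ there is $B$ such that for all $t_0\ge0$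 and all $z_0$, $\|z_0-\bar z\|\le R$ implies $\|s(t;z_0,t_0)-\bar z\|\le B$ for all $t\ge t_0$; (iii) (uniformly attracting in the large) for all $\rho>0$ and $\eta>0$ there is $T\ge 0$ such that for all $t_0\ge0$ and all $z_0$, $\|z_0-\bar z\|\le\rho$ implies $\|s(t;z_0,t_0)-\bar z\|\le\eta$ for all $t\ge t_0+T$. -/

import Mathlib

noncomputable section

namespace CRMStability

variable {E : Type*} [NormedAddCommGroup E]

/-- `s t x₀ t₀` is a transition function of `ẋ(t) = f (x(t), t)`: for every initial time `t₀ ≥ 0` and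
every initial state `x₀`, the map `t ↦ s t x₀ t₀` solves the equation on all of `[t₀, ∞)` (with the
one-sided derivative at `t₀`) and equals `x₀` at time `t₀`. -/
def IsTransitionFunction [NormedSpace ℝ E] (f : E → ℝ → E) (s : ℝ → E → ℝ → E) : Prop :=
  ∀ t₀ : ℝ, 0 ≤ t₀ → ∀ x₀ : E, s t₀ x₀ t₀ = x₀ ∧
    ∀ t : ℝ, t₀ ≤ t →
      HasDerivWithinAt (fun τ => s τ x₀ t₀) (f (s t x₀ t₀) t) (Set.Ici t₀) t

/-- The state `p` is an equilibrium of `ẋ(t) = f (x(t), t)`. -/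
def IsEquilibrium (f : E → ℝ → E) (p : E) : Prop :=
  ∀ t : ℝ, 0 ≤ t → f p t = 0

/-- Uniform stability of `p`: `δ` depends only on `ε`. -/
def UniformlyStable (s : ℝ → E → ℝ → E) (p : E) : Prop :=
  ∀ ε : ℝ, 0 < ε → ∃ δ : ℝ, 0 < δ ∧
    ∀ t₀ : ℝ, 0 ≤ t₀ → ∀ x₀ : E, ‖x₀ - p‖ ≤ δ →
      ∀ t : ℝ, t₀ ≤ t → ‖s t x₀ t₀ - p‖ ≤ ε

/-- Uniform boundedness relative to `p`: `B` depends only on `r`. -/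
def UniformlyBounded (s : ℝ → E → ℝ → E) (p : E) : Prop :=
  ∀ r : ℝ, 0 < r → ∃ B : ℝ,
    ∀ t₀ : ℝ, 0 ≤ t₀ → ∀ x₀ : E, ‖x₀ - p‖ ≤ r →
      ∀ t : ℝ, t₀ ≤ t → ‖s t x₀ t₀ - p‖ ≤ B

/-- Uniform attraction in the large of `p`: `T` depends only on `ρ` and `η`. -/
def UniformlyAttractingInTheLarge (s : ℝ → E → ℝ → E) (p : E) : Prop :=
  ∀ ρ : ℝ, 0 < ρ → ∀ η : ℝ, 0 < η → ∃ T : ℝ, 0 ≤ T ∧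
    ∀ t₀ : ℝ, 0 ≤ t₀ → ∀ x₀ : E, ‖x₀ - p‖ ≤ ρ →
      ∀ t : ℝ, t₀ + T ≤ t → ‖s t x₀ t₀ - p‖ ≤ η

/-- Uniform asymptotic stability in the large (UASL) of `p`. -/
def UASL (s : ℝ → E → ℝ → E) (p : E) : Prop :=
  UniformlyStable s p ∧ UniformlyBounded s p ∧ UniformlyAttractingInTheLarge s p

/-- Right-hand side of the scalar closed-loop reference model (CRM) adaptive system with constant
reference input `r`; the state is `z = [x_m, e, φ]`, and the plant state is `x = e + x_m`. -/
def crmField (a b γ r ℓ : ℝ) (z : EuclideanSpace ℝ (Fin 3)) (_t : ℝ) :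
    EuclideanSpace ℝ (Fin 3) :=
  !₂[a * z 0 + b * r - ℓ * z 1,
     (a + ℓ) * z 1 + b * z 2 * (z 1 + z 0),
     -γ * z 1 * (z 1 + z 0)]

/-- The state `[x̄, 0, 0]` with `x̄ = -b r / a`. -/
def crmEquilibrium (a b r : ℝ) : EuclideanSpace ℝ (Fin 3) :=
  !₂[-b * r / a, 0, 0]

end CRMStability

end

/-! Put `ξ = x_m - x̄`. The weights in `crmLyapunov` make the `φ` terms of its derivative cancel,
and what remains is negative definite in `(ξ, e)` (`crmLyapunovDeriv_le`). This gives stability and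
boundedness. The bound survives multiplying the field by any nonnegative factor, so the field may be
cut off outside a large ball: the cut-off field has global solutions, and they never reach the
cut-off region.

Attraction needs decay in `φ`. The derivative of `x̄ e φ` contains `b x̄² φ²`, nonzero because `r ≠
0`. Subtracting this product from a large multiple of the weak function gives a strict Lyapunov
function on each ball (`exists_strict_crmLyapunov`), hence an exponential rate that depends only on
the ball of initial states. -/

namespace CRMStability

open Set

/-! ### Global forward solutions for bounded Lipschitz fields. -/

section GlobalSolutions

variable {E : Type*} [NormedAddCommGroup E] [NormedSpace ℝ E]

/-- Two solutions of an autonomous Lipschitz equation on a compact interval which agree at the left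
endpoint agree on the interval. -/
theorem eqOn_Icc_of_hasDerivWithinAt_of_lipschitzWith {f : E → E} {K : NNReal}
    (hf : LipschitzWith K f) {α β : ℝ → E} {t₀ T : ℝ} (h₀ : α t₀ = β t₀)
    (hα : ∀ t ∈ Icc t₀ T, HasDerivWithinAt α (f (α t)) (Icc t₀ T) t)
    (hβ : ∀ t ∈ Icc t₀ T, HasDerivWithinAt β (f (β t)) (Icc t₀ T) t) :
    EqOn α β (Icc t₀ T) := by
  have key : ∀ u : ℝ → E, (∀ t ∈ Icc t₀ T, HasDerivWithinAt u (f (u t)) (Icc t₀ T) t) →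
      ∀ t ∈ Ico t₀ T, HasDerivWithinAt u (f (u t)) (Ici t) t := fun u hu t ht =>
    (hu t ⟨ht.1, ht.2.le⟩).mono_of_mem_nhdsWithin
      (Filter.mem_of_superset (Icc_mem_nhdsGE ht.2) (Icc_subset_Icc_left ht.1))
  exact ODE_solution_unique (v := fun _ => f) (fun _ => hf)
    (fun t ht => (hα t ht).continuousWithinAt) (key α hα)
    (fun t ht => (hβ t ht).continuousWithinAt) (key β hβ) h₀

/-- A bounded Lipschitz autonomous vector field has forward solutions for all times. -/
theorem exists_hasDerivWithinAt_Ici_of_lipschitzWith_of_bounded [CompleteSpace E] {f : E → E}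
    {K L : NNReal} (hf : LipschitzWith K f) (hL : ∀ x, ‖f x‖ ≤ L) (t₀ : ℝ) (x₀ : E) :
    ∃ α : ℝ → E, α t₀ = x₀ ∧ ∀ t, t₀ ≤ t → HasDerivWithinAt α (f (α t)) (Ici t₀) t := by
  have hex : ∀ n : ℕ, ∃ α : ℝ → E, α t₀ = x₀ ∧
      ∀ t ∈ Icc t₀ (t₀ + n), HasDerivWithinAt α (f (α t)) (Icc t₀ (t₀ + n)) t := by
    intro n
    have hmem : t₀ ∈ Icc t₀ (t₀ + n) := ⟨le_rfl, by simp⟩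
    have hPL : IsPicardLindelof (fun _ => f) (⟨t₀, hmem⟩ : Icc t₀ (t₀ + n)) x₀ (L * n) 0 L K :=
      IsPicardLindelof.of_time_independent (fun x _ => hL x) (hf.lipschitzOnWith) (by simp)
    exact hPL.exists_eq_forall_mem_Icc_hasDerivWithinAt₀
  choose α hα₀ hα using hex
  have hagree : ∀ m n : ℕ, m ≤ n → EqOn (α m) (α n) (Icc t₀ (t₀ + m)) := by
    intro m n hmn
    have hsub : Icc t₀ (t₀ + (m : ℝ)) ⊆ Icc t₀ (t₀ + (n : ℝ)) :=
      Icc_subset_Icc_right (by gcongr)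
    exact eqOn_Icc_of_hasDerivWithinAt_of_lipschitzWith hf ((hα₀ m).trans (hα₀ n).symm) (hα m)
      fun t ht => (hα n t (hsub ht)).mono hsub
  refine ⟨fun t => α ⌈t - t₀⌉₊ t, hα₀ _, fun t ht => ?_⟩
  -- The extra `1` puts `t` strictly before the right end, so a derivative within the interval is
  -- one within `Ici t₀`.
  set n : ℕ := ⌈t - t₀⌉₊ + 1 with hn
  have hlt : t < t₀ + n := by
    have := Nat.le_ceil (t - t₀)
    rw [hn]; push_cast; linarith
  have heq : ∀ τ ∈ Icc t₀ (t₀ + (n : ℝ)), α ⌈τ - t₀⌉₊ τ = α n τ := by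
    intro τ hτ
    refine hagree _ _ (Nat.ceil_le.2 (by linarith [hτ.2])) ⟨hτ.1, ?_⟩
    linarith [Nat.le_ceil (τ - t₀)]
  have htm : t ∈ Icc t₀ (t₀ + (n : ℝ)) := ⟨ht, hlt.le⟩
  have hd := (hα n t htm).congr heq (heq t htm)
  rw [← heq t htm] at hd
  refine hd.mono_of_mem_nhdsWithin ?_
  filter_upwards [self_mem_nhdsWithin, mem_nhdsWithin_of_mem_nhds (Iio_mem_nhds hlt)] with τ h₁ h₂
  exact ⟨h₁, le_of_lt h₂⟩

end GlobalSolutions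

/-! ### Coordinates and the unique equilibrium. -/

section Coordinates

theorem norm_sub_crmEquilibrium_sq (a b r : ℝ) (z : EuclideanSpace ℝ (Fin 3)) :
    ‖z - crmEquilibrium a b r‖ ^ 2 = (z 0 - -b * r / a) ^ 2 + z 1 ^ 2 + z 2 ^ 2 := by
  rw [EuclideanSpace.norm_sq_eq, Fin.sum_univ_three]
  simp [crmEquilibrium]

theorem contDiff_crmField (a b γ r ℓ : ℝ) {n : WithTop ℕ∞} :
    ContDiff ℝ n (fun z => crmField a b γ r ℓ z 0) := by
  rw [contDiff_euclidean]
  intro i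
  fin_cases i <;> simp [crmField] <;> fun_prop

theorem isEquilibrium_crmField_iff {a b γ r ℓ : ℝ} (ha : a < 0) (hb : 0 < b) (hγ : 0 < γ)
    (hℓ : ℓ < 0) (hr : r ≠ 0) (p : EuclideanSpace ℝ (Fin 3)) :
    IsEquilibrium (crmField a b γ r ℓ) p ↔ p = crmEquilibrium a b r := by
  constructor
  · intro h
    have h := h 0 le_rfl
    have h0 : a * p 0 + b * r - ℓ * p 1 = 0 := congrArg (fun z : EuclideanSpace ℝ (Fin 3) => z 0) h
    have h1 : (a + ℓ) * p 1 + b * p 2 * (p 1 + p 0) = 0 :=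
      congrArg (fun z : EuclideanSpace ℝ (Fin 3) => z 1) h
    have h2 : -γ * p 1 * (p 1 + p 0) = 0 := congrArg (fun z : EuclideanSpace ℝ (Fin 3) => z 2) h
    have hbr : b * r ≠ 0 := mul_ne_zero hb.ne' hr
    have hp1 : p 1 = 0 := by
      rcases mul_eq_zero.1 h2 with h2 | h2
      · exact (mul_eq_zero.1 h2).resolve_left (neg_ne_zero.2 hγ.ne')
      · rw [h2, mul_zero, add_zero] at h1
        exact (mul_eq_zero.1 h1).resolve_left (by linarith)
    have hp0 : p 0 = -b * r / a := by
      rw [eq_div_iff ha.ne]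
      rw [hp1] at h0
      linarith
    have hp0' : p 0 ≠ 0 := by
      intro h
      rw [h, hp1] at h0
      exact hbr (by linarith)
    have hp2 : p 2 = 0 := by
      rw [hp1, mul_zero, zero_add, zero_add] at h1
      exact (mul_eq_zero.1 ((mul_eq_zero.1 h1).resolve_right hp0')).resolve_left hb.ne'
    ext i
    fin_cases i
    · exact hp0
    · exact hp1
    · exact hp2
  · rintro rfl t -
    ext i
    fin_cases i
    · have h : a * (-(b * r) / a) = -(b * r) := mul_div_cancel₀ _ ha.ne
      simp [crmField, crmEquilibrium, h]
    · simp [crmField, crmEquilibrium]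
    · simp [crmField, crmEquilibrium]

/-- Coordinatewise derivatives of a curve that follows a rescaled CRM field. -/
theorem hasDerivWithinAt_apply_of_smul_crmField {a b γ r ℓ k t : ℝ} {S : Set ℝ}
    {z : ℝ → EuclideanSpace ℝ (Fin 3)}
    (hz : HasDerivWithinAt z (k • crmField a b γ r ℓ (z t) 0) S t) :
    HasDerivWithinAt (fun τ => z τ 0) (k * (a * z t 0 + b * r - ℓ * z t 1)) S t ∧
    HasDerivWithinAt (fun τ => z τ 1)
      (k * ((a + ℓ) * z t 1 + b * z t 2 * (z t 1 + z t 0))) S t ∧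
    HasDerivWithinAt (fun τ => z τ 2) (k * (-γ * z t 1 * (z t 1 + z t 0))) S t :=
  ⟨(EuclideanSpace.proj (𝕜 := ℝ) (0 : Fin 3)).hasFDerivAt.comp_hasDerivWithinAt t hz,
   (EuclideanSpace.proj (𝕜 := ℝ) (1 : Fin 3)).hasFDerivAt.comp_hasDerivWithinAt t hz,
   (EuclideanSpace.proj (𝕜 := ℝ) (2 : Fin 3)).hasFDerivAt.comp_hasDerivWithinAt t hz⟩

end Coordinates

/-! ### Weak and strict Lyapunov functions. -/

section Lyapunov

/-- A weak Lyapunov function of the CRM system, in the deviations `ξ = x_m - x̄`, `e`, `φ`. -/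
noncomputable def crmLyapunov (a b γ ℓ ξ e φ : ℝ) : ℝ :=
  a * (a + ℓ) * ξ ^ 2 + ℓ ^ 2 * (e ^ 2 + b / γ * φ ^ 2)

theorem crmLyapunov_bounds {a b γ ℓ : ℝ} (ha : a < 0) (hb : 0 < b) (hγ : 0 < γ) (hℓ : ℓ < 0) :
    ∃ c C : ℝ, 0 < c ∧ 0 < C ∧ ∀ ξ e φ : ℝ,
      c * (ξ ^ 2 + e ^ 2 + φ ^ 2) ≤ crmLyapunov a b γ ℓ ξ e φ ∧
      crmLyapunov a b γ ℓ ξ e φ ≤ C * (ξ ^ 2 + e ^ 2 + φ ^ 2) := by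
  have h1 : 0 < a * (a + ℓ) := mul_pos_of_neg_of_neg ha (by linarith)
  have h2 : 0 < ℓ ^ 2 := sq_pos_of_neg hℓ
  have h3 : 0 < ℓ ^ 2 * (b / γ) := by positivity
  refine ⟨min (a * (a + ℓ)) (min (ℓ ^ 2) (ℓ ^ 2 * (b / γ))),
    a * (a + ℓ) + ℓ ^ 2 + ℓ ^ 2 * (b / γ), lt_min h1 (lt_min h2 h3), by linarith, fun ξ e φ => ⟨?_, ?_⟩⟩
  · have m1 : min (a * (a + ℓ)) (min (ℓ ^ 2) (ℓ ^ 2 * (b / γ))) ≤ a * (a + ℓ) := min_le_left _ _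
    have m2 : min (a * (a + ℓ)) (min (ℓ ^ 2) (ℓ ^ 2 * (b / γ))) ≤ ℓ ^ 2 :=
      (min_le_right _ _).trans (min_le_left _ _)
    have m3 : min (a * (a + ℓ)) (min (ℓ ^ 2) (ℓ ^ 2 * (b / γ))) ≤ ℓ ^ 2 * (b / γ) :=
      (min_le_right _ _).trans (min_le_right _ _)
    have := mul_le_mul_of_nonneg_right m1 (sq_nonneg ξ)
    have := mul_le_mul_of_nonneg_right m2 (sq_nonneg e)
    have := mul_le_mul_of_nonneg_right m3 (sq_nonneg φ)
    unfold crmLyapunov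
    linarith
  · have : 0 ≤ a * (a + ℓ) * (e ^ 2 + φ ^ 2) := by positivity
    have : 0 ≤ ℓ ^ 2 * (ξ ^ 2 + φ ^ 2) := by positivity
    have : 0 ≤ ℓ ^ 2 * (b / γ) * (ξ ^ 2 + e ^ 2) := by positivity
    unfold crmLyapunov
    linarith

/-- The derivative of `crmLyapunov` along the CRM field. -/
def crmLyapunovDeriv (a ℓ ξ e : ℝ) : ℝ :=
  2 * (a * (a + ℓ)) * ξ * (a * ξ - ℓ * e) + 2 * ℓ ^ 2 * (a + ℓ) * e ^ 2

/-- Completing the square: the derivative equals `(a + ℓ)((aξ - ℓe)² + a²ξ² + ℓ²e²)`, and `a + ℓ <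
0`. -/
theorem crmLyapunovDeriv_le {a ℓ : ℝ} (ha : a < 0) (hℓ : ℓ < 0) :
    ∃ c : ℝ, 0 < c ∧ ∀ ξ e : ℝ, crmLyapunovDeriv a ℓ ξ e ≤ -c * (ξ ^ 2 + e ^ 2) := by
  have hq : 0 < -(a + ℓ) := by linarith
  refine ⟨-(a + ℓ) * min (a ^ 2) (ℓ ^ 2),
    mul_pos hq (lt_min (sq_pos_of_neg ha) (sq_pos_of_neg hℓ)), fun ξ e => ?_⟩
  have h : 0 ≤ -(a + ℓ) * ((a * ξ - ℓ * e) ^ 2 + (a ^ 2 - min (a ^ 2) (ℓ ^ 2)) * ξ ^ 2 +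
      (ℓ ^ 2 - min (a ^ 2) (ℓ ^ 2)) * e ^ 2) := by
    have := sub_nonneg.2 (min_le_left (a ^ 2) (ℓ ^ 2))
    have := sub_nonneg.2 (min_le_right (a ^ 2) (ℓ ^ 2))
    positivity
  unfold crmLyapunovDeriv
  linarith

/-- The weight `b / γ` cancels the `e φ x` terms. The factor `k` serves the cut-off field. -/
theorem hasDerivWithinAt_crmLyapunov {a b γ r ℓ k t : ℝ} (ha : a ≠ 0) (hγ : γ ≠ 0) {S : Set ℝ}
    {z : ℝ → EuclideanSpace ℝ (Fin 3)}
    (hz : HasDerivWithinAt z (k • crmField a b γ r ℓ (z t) 0) S t) :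
    HasDerivWithinAt (fun τ => crmLyapunov a b γ ℓ (z τ 0 - -b * r / a) (z τ 1) (z τ 2))
      (k * crmLyapunovDeriv a ℓ (z t 0 - -b * r / a) (z t 1)) S t := by
  obtain ⟨h0, h1, h2⟩ := hasDerivWithinAt_apply_of_smul_crmField hz
  have h := (((h0.sub_const (-b * r / a)).pow 2).const_mul (a * (a + ℓ))).add
    (((h1.pow 2).add ((h2.pow 2).const_mul (b / γ))).const_mul (ℓ ^ 2))
  refine h.congr_deriv ?_
  have hx : a * (-b * r / a) = -b * r := mul_div_cancel₀ _ ha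
  have hb : b / γ * γ = b := div_mul_cancel₀ _ hγ
  simp only [crmLyapunovDeriv]
  linear_combination (2 * (a * (a + ℓ)) * (z t 0 - -b * r / a) * k) * hx -
    (2 * ℓ ^ 2 * k * z t 1 * z t 2 * (z t 1 + z t 0)) * hb

/-- Trajectories of a nonnegatively rescaled CRM field stay within a fixed multiple of their initial
distance to the equilibrium. -/
theorem exists_norm_sub_crmEquilibrium_le {a b γ ℓ : ℝ} (r : ℝ) (ha : a < 0) (hb : 0 < b)
    (hγ : 0 < γ) (hℓ : ℓ < 0) :
    ∃ C : ℝ, 0 < C ∧ ∀ (z : ℝ → EuclideanSpace ℝ (Fin 3)) (k : ℝ → ℝ) (t₀ : ℝ), (∀ t, 0 ≤ k t) →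
      (∀ t, t₀ ≤ t → HasDerivWithinAt z (k t • crmField a b γ r ℓ (z t) 0) (Ici t₀) t) →
      ∀ t, t₀ ≤ t → ‖z t - crmEquilibrium a b r‖ ≤ C * ‖z t₀ - crmEquilibrium a b r‖ := by
  obtain ⟨c₁, c₂, hc₁, hc₂, hbd⟩ := crmLyapunov_bounds ha hb hγ hℓ
  obtain ⟨c₃, hc₃, hdec⟩ := crmLyapunovDeriv_le ha hℓ
  -- With `q = c₂ / c₁`, `q ≤ (q + 1)²` avoids a square root.
  refine ⟨c₂ / c₁ + 1, by positivity, fun z k t₀ hk hz t ht => ?_⟩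
  have hd := fun t ht => hasDerivWithinAt_crmLyapunov ha.ne hγ.ne' (hz t ht)
  have hanti := antitoneOn_of_hasDerivWithinAt_nonpos (convex_Ici t₀)
    (fun t ht => (hd t ht).continuousWithinAt)
    (fun t ht => (hd t (interior_subset ht)).mono interior_subset)
    (fun t _ => by
      refine mul_nonpos_of_nonneg_of_nonpos (hk t) ((hdec _ _).trans ?_)
      rw [neg_mul, neg_nonpos]
      positivity)
  have hle := hanti self_mem_Ici ht ht
  have hl := (hbd (z t 0 - -b * r / a) (z t 1) (z t 2)).1
  have hu := (hbd (z t₀ 0 - -b * r / a) (z t₀ 1) (z t₀ 2)).2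
  rw [← norm_sub_crmEquilibrium_sq] at hl hu
  have hsq : ‖z t - crmEquilibrium a b r‖ ^ 2 ≤ c₂ / c₁ * ‖z t₀ - crmEquilibrium a b r‖ ^ 2 := by
    rw [div_mul_eq_mul_div, le_div_iff₀ hc₁]
    linarith
  refine le_of_sq_le_sq (hsq.trans ?_) (by positivity)
  rw [mul_pow]
  gcongr
  have : 0 ≤ c₂ / c₁ := by positivity
  nlinarith

/-- The derivative of `x̄ e φ` along the CRM field. -/
def crmCrossDeriv (a b γ ℓ xbar ξ e φ : ℝ) : ℝ :=
  xbar * (((a + ℓ) * e + b * φ * (e + (ξ + xbar))) * φ + e * (-γ * e * (e + (ξ + xbar))))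

theorem hasDerivWithinAt_crmCross {a b γ r ℓ t : ℝ} (xbar : ℝ) {S : Set ℝ}
    {z : ℝ → EuclideanSpace ℝ (Fin 3)} (hz : HasDerivWithinAt z (crmField a b γ r ℓ (z t) 0) S t) :
    HasDerivWithinAt (fun τ => xbar * (z τ 1 * z τ 2))
      (crmCrossDeriv a b γ ℓ xbar (z t 0 - xbar) (z t 1) (z t 2)) S t := by
  rw [← one_smul ℝ (crmField a b γ r ℓ (z t) 0)] at hz
  obtain ⟨-, h1, h2⟩ := hasDerivWithinAt_apply_of_smul_crmField hz
  refine ((h1.mul h2).const_mul xbar).congr_deriv ?_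
  simp only [crmCrossDeriv]
  ring

/-- Half of `b x̄² φ²` absorbs the mixed terms by Young's inequality; on the ball, the rest is at
most a constant times `ξ² + e²`. -/
theorem crmCrossDeriv_ge {a b γ ℓ xbar M : ℝ} (hb : 0 < b) (hγ : 0 < γ) (hx : xbar ≠ 0)
    {ξ e φ : ℝ} (hM : ξ ^ 2 + e ^ 2 + φ ^ 2 ≤ M) :
    b * xbar ^ 2 / 2 * φ ^ 2 -
        ((a + ℓ) ^ 2 / b + 2 * b * M + γ * (3 * xbar ^ 2 / 2 + M)) * (ξ ^ 2 + e ^ 2) ≤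
      crmCrossDeriv a b γ ℓ xbar ξ e φ := by
  have hM0 : 0 ≤ M := le_trans (by positivity) hM
  have hφ : φ ^ 2 ≤ M := by nlinarith [sq_nonneg ξ, sq_nonneg e]
  have hξe : ξ ^ 2 + e ^ 2 ≤ M := by nlinarith [sq_nonneg φ]
  have hs : (ξ + e) ^ 2 ≤ 2 * (ξ ^ 2 + e ^ 2) := by nlinarith [sq_nonneg (ξ - e)]
  have hcross : -(b * xbar ^ 2 / 2 * φ ^ 2) - ((a + ℓ) ^ 2 / b * e ^ 2 + b * φ ^ 2 * (ξ + e) ^ 2) ≤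
      xbar * φ * ((a + ℓ) * e + b * φ * (ξ + e)) := by
    -- These squares are the deficits in Young's inequality and in `(A + B)² ≤ 2A² + 2B²`, with `A =
    -- (a + ℓ)e` and `B = bφ(ξ + e)`.
    have h1 : 0 ≤ (b * xbar * φ + ((a + ℓ) * e + b * φ * (ξ + e))) ^ 2 / (2 * b) := by positivity
    have h2 : 0 ≤ ((a + ℓ) * e - b * φ * (ξ + e)) ^ 2 / (2 * b) := by positivity
    have h3 : xbar * φ * ((a + ℓ) * e + b * φ * (ξ + e)) -
        (-(b * xbar ^ 2 / 2 * φ ^ 2) - ((a + ℓ) ^ 2 / b * e ^ 2 + b * φ ^ 2 * (ξ + e) ^ 2)) =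
        (b * xbar * φ + ((a + ℓ) * e + b * φ * (ξ + e))) ^ 2 / (2 * b) +
        ((a + ℓ) * e - b * φ * (ξ + e)) ^ 2 / (2 * b) := by
      field_simp
      ring
    linarith
  have hsq : b * φ ^ 2 * (ξ + e) ^ 2 ≤ 2 * b * M * (ξ ^ 2 + e ^ 2) := by
    calc b * φ ^ 2 * (ξ + e) ^ 2 ≤ b * M * (2 * (ξ ^ 2 + e ^ 2)) := by gcongr
      _ = _ := by ring
  have hxx : xbar * (e + (ξ + xbar)) ≤ 3 * xbar ^ 2 / 2 + M := by
    nlinarith [sq_nonneg (xbar - (ξ + e))]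
  have hlast : γ * e ^ 2 * (xbar * (e + (ξ + xbar))) ≤
      γ * (3 * xbar ^ 2 / 2 + M) * (ξ ^ 2 + e ^ 2) := by
    calc γ * e ^ 2 * (xbar * (e + (ξ + xbar))) ≤ γ * e ^ 2 * (3 * xbar ^ 2 / 2 + M) := by gcongr
      _ = γ * (3 * xbar ^ 2 / 2 + M) * e ^ 2 := by ring
      _ ≤ _ := by gcongr; nlinarith [sq_nonneg ξ]
  have hq : 0 ≤ (a + ℓ) ^ 2 / b * ξ ^ 2 := by positivity
  have : crmCrossDeriv a b γ ℓ xbar ξ e φ = b * xbar ^ 2 * φ ^ 2 +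
      xbar * φ * ((a + ℓ) * e + b * φ * (ξ + e)) - γ * e ^ 2 * (xbar * (e + (ξ + xbar))) := by
    unfold crmCrossDeriv
    ring
  rw [this]
  linarith

/-- On every ball around the equilibrium, `N * crmLyapunov - x̄ e φ` is a strict Lyapunov function
once `N` is large enough. -/
theorem exists_strict_crmLyapunov {a b γ ℓ xbar M : ℝ} (ha : a < 0) (hb : 0 < b) (hγ : 0 < γ)
    (hℓ : ℓ < 0) (hx : xbar ≠ 0) (hM : 0 ≤ M) :
    ∃ N C κ : ℝ, 0 < C ∧ 0 < κ ∧ ∀ ξ e φ : ℝ,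
      ξ ^ 2 + e ^ 2 + φ ^ 2 ≤ N * crmLyapunov a b γ ℓ ξ e φ - xbar * (e * φ) ∧
      N * crmLyapunov a b γ ℓ ξ e φ - xbar * (e * φ) ≤ C * (ξ ^ 2 + e ^ 2 + φ ^ 2) ∧
      (ξ ^ 2 + e ^ 2 + φ ^ 2 ≤ M →
        N * crmLyapunovDeriv a ℓ ξ e - crmCrossDeriv a b γ ℓ xbar ξ e φ ≤
          -κ * (N * crmLyapunov a b γ ℓ ξ e φ - xbar * (e * φ))) := by
  obtain ⟨c₁, c₂, hc₁, hc₂, hbd⟩ := crmLyapunov_bounds ha hb hγ hℓ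
  obtain ⟨c₃, hc₃, hdec⟩ := crmLyapunovDeriv_le ha hℓ
  set K := (a + ℓ) ^ 2 / b + 2 * b * M + γ * (3 * xbar ^ 2 / 2 + M) with hK
  have hK0 : 0 ≤ K := by positivity
  -- The first summand makes the function dominate the squared distance despite the cross term; the
  -- second beats `K` with `1` to spare.
  set N := (xbar ^ 2 + 2) / c₁ + (K + 1) / c₃ with hN
  have hN1 : xbar ^ 2 + 2 ≤ N * c₁ := by
    rw [← div_le_iff₀ hc₁, hN]
    have : 0 ≤ (K + 1) / c₃ := by positivity
    linarith
  have hN3 : K + 1 ≤ N * c₃ := by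
    rw [← div_le_iff₀ hc₃, hN]
    have : 0 ≤ (xbar ^ 2 + 2) / c₁ := by positivity
    linarith
  have hN0 : 0 ≤ N := by positivity
  set C := N * c₂ + (xbar ^ 2 + 1) with hC
  have hC0 : 0 < C := by positivity
  set m := min 1 (b * xbar ^ 2 / 2) with hm
  have hm0 : 0 < m := by positivity
  refine ⟨N, C, m / C, hC0, by positivity, fun ξ e φ => ?_⟩
  set D := ξ ^ 2 + e ^ 2 + φ ^ 2 with hD
  have hD0 : 0 ≤ D := by positivity
  have hcr : |xbar * (e * φ)| ≤ (xbar ^ 2 + 1) * D := by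
    have h1 : 0 ≤ xbar ^ 2 * (ξ ^ 2 + φ ^ 2) := by positivity
    have h2 : 0 ≤ xbar ^ 2 * e ^ 2 := by positivity
    rw [abs_le, hD]
    constructor <;>
      nlinarith [sq_nonneg (xbar * e - φ), sq_nonneg (xbar * e + φ), sq_nonneg ξ, sq_nonneg e,
        sq_nonneg φ]
  rw [abs_le] at hcr
  obtain ⟨hl, hu⟩ := hbd ξ e φ
  have hl' := mul_le_mul_of_nonneg_left hl hN0
  have hu' := mul_le_mul_of_nonneg_left hu hN0
  have hup : N * crmLyapunov a b γ ℓ ξ e φ - xbar * (e * φ) ≤ C * D := by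
    rw [hC]
    linarith
  refine ⟨?_, hup, fun hDM => ?_⟩
  · have := mul_le_mul_of_nonneg_right hN1 hD0
    linarith
  · have h1 := mul_le_mul_of_nonneg_left (hdec ξ e) hN0
    have h2 := crmCrossDeriv_ge (a := a) (ℓ := ℓ) hb hγ hx hDM
    rw [← hK] at h2
    have h3 : (K + 1) * (ξ ^ 2 + e ^ 2) ≤ N * c₃ * (ξ ^ 2 + e ^ 2) := by gcongr
    have h4 : m * (ξ ^ 2 + e ^ 2) ≤ 1 * (ξ ^ 2 + e ^ 2) := by gcongr; exact min_le_left _ _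
    have h5 : m * φ ^ 2 ≤ b * xbar ^ 2 / 2 * φ ^ 2 := by gcongr; exact min_le_right _ _
    have h6 := mul_le_mul_of_nonneg_left hup (by positivity : 0 ≤ m / C)
    have h7 : m / C * (C * D) = m * D := by field_simp
    have h8 : m * D = m * (ξ ^ 2 + e ^ 2) + m * φ ^ 2 := by rw [hD]; ring
    linarith

/-- Exponential convergence of the CRM trajectories, uniform on bounded sets of initial states. -/
theorem exists_exp_bound_crmField {a b γ r ℓ : ℝ} (ha : a < 0) (hb : 0 < b) (hγ : 0 < γ)
    (hℓ : ℓ < 0) (hr : r ≠ 0) (ρ : ℝ) :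
    ∃ C κ : ℝ, 0 < C ∧ 0 < κ ∧ ∀ (z : ℝ → EuclideanSpace ℝ (Fin 3)) (t₀ : ℝ),
      (∀ t, t₀ ≤ t → HasDerivWithinAt z (crmField a b γ r ℓ (z t) 0) (Ici t₀) t) →
      ‖z t₀ - crmEquilibrium a b r‖ ≤ ρ → ∀ t, t₀ ≤ t →
        ‖z t - crmEquilibrium a b r‖ ^ 2 * Real.exp (κ * (t - t₀)) ≤
          C * ‖z t₀ - crmEquilibrium a b r‖ ^ 2 := by
  obtain ⟨B, hB, hbdd⟩ := exists_norm_sub_crmEquilibrium_le r ha hb hγ hℓ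
  have hx : -b * r / a ≠ 0 := div_ne_zero (mul_ne_zero (neg_ne_zero.2 hb.ne') hr) ha.ne
  obtain ⟨N, C, κ, hC, hκ, hS⟩ := exists_strict_crmLyapunov ha hb hγ hℓ hx (sq_nonneg (B * ρ))
  refine ⟨C, κ, hC, hκ, fun z t₀ hz hρ t ht => ?_⟩
  have hz1 : ∀ t, t₀ ≤ t →
      HasDerivWithinAt z ((1 : ℝ) • crmField a b γ r ℓ (z t) 0) (Ici t₀) t := fun t ht => by
    rw [one_smul]
    exact hz t ht
  have hball : ∀ t, t₀ ≤ t →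
      (z t 0 - -b * r / a) ^ 2 + z t 1 ^ 2 + z t 2 ^ 2 ≤ (B * ρ) ^ 2 := fun t ht => by
    rw [← norm_sub_crmEquilibrium_sq]
    have := hbdd z (fun _ => 1) t₀ (fun _ => zero_le_one) hz1 t ht
    gcongr
    exact this.trans (by gcongr)
  -- The strict Lyapunov function times `exp(κ(t - t₀))` is nonincreasing.
  have hd := fun t ht => ((((hasDerivWithinAt_crmLyapunov ha.ne hγ.ne' (hz1 t ht)).const_mul N).sub
    (hasDerivWithinAt_crmCross (-b * r / a) (hz t ht))).mul
    ((((hasDerivAt_id t).sub_const t₀).const_mul κ).exp.hasDerivWithinAt (s := Ici t₀)))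
  have hanti := antitoneOn_of_hasDerivWithinAt_nonpos (convex_Ici t₀)
    (fun t ht => (hd t ht).continuousWithinAt)
    (fun t ht => (hd t (interior_subset ht)).mono interior_subset)
    (fun t ht => by
      have h := (hS _ _ _).2.2 (hball t (interior_subset ht))
      have h' := mul_le_mul_of_nonneg_right h (Real.exp_pos (κ * (t - t₀))).le
      simp only [Pi.sub_apply, id] at h' ⊢
      linarith)
  have hle := hanti self_mem_Ici ht ht
  simp only [Pi.mul_apply, Pi.sub_apply, id, sub_self, mul_zero, Real.exp_zero, mul_one] at hle
  rw [norm_sub_crmEquilibrium_sq, norm_sub_crmEquilibrium_sq]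
  calc _ ≤ _ := mul_le_mul_of_nonneg_right (hS _ _ _).1 (Real.exp_pos _).le
    _ ≤ _ := hle
    _ ≤ _ := (hS _ _ _).2.1

end Lyapunov

/-! ### Global existence and UASL. -/

/-- The CRM system has forward solutions for all times. -/
theorem exists_solution_crmField {a b γ ℓ : ℝ} (r : ℝ) (ha : a < 0) (hb : 0 < b) (hγ : 0 < γ)
    (hℓ : ℓ < 0) (t₀ : ℝ) (z₀ : EuclideanSpace ℝ (Fin 3)) :
    ∃ z : ℝ → EuclideanSpace ℝ (Fin 3), z t₀ = z₀ ∧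
      ∀ t, t₀ ≤ t → HasDerivWithinAt z (crmField a b γ r ℓ (z t) 0) (Ici t₀) t := by
  obtain ⟨B, hB, hbdd⟩ := exists_norm_sub_crmEquilibrium_le r ha hb hγ hℓ
  set p := crmEquilibrium a b r
  -- The field cut off outside a ball that trajectories from `z₀` never leave.
  let χ : ContDiffBump p :=
    ⟨B * ‖z₀ - p‖ + 1, B * ‖z₀ - p‖ + 2, by positivity, by linarith⟩
  have hsmooth : ContDiff ℝ 1 (fun z => χ z • crmField a b γ r ℓ z 0) :=
    χ.contDiff.smul (contDiff_crmField a b γ r ℓ)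
  have hsupp : HasCompactSupport (fun z => χ z • crmField a b γ r ℓ z 0) :=
    χ.hasCompactSupport.smul_right
  obtain ⟨K, hK⟩ := hsmooth.lipschitzWith_of_hasCompactSupport hsupp one_ne_zero
  obtain ⟨L, hL⟩ := hsupp.exists_bound_of_continuous hsmooth.continuous
  obtain ⟨z, hz₀, hz⟩ := exists_hasDerivWithinAt_Ici_of_lipschitzWith_of_bounded hK
    (L := L.toNNReal) (fun x => (hL x).trans (Real.le_coe_toNNReal L)) t₀ z₀
  refine ⟨z, hz₀, fun t ht => ?_⟩
  -- The cut-off is itself the nonnegative rescaling, so the a priori bound keeps `z` where `χ = 1`.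
  have hball := hbdd z (fun t => χ (z t)) t₀ (fun t => χ.nonneg) hz t ht
  have hone : χ (z t) = 1 := χ.one_of_mem_closedBall <| by
    rw [mem_closedBall_iff_norm]
    rw [hz₀] at hball
    exact hball.trans (by simp [χ])
  simpa only [hone, one_smul] using hz t ht

theorem uasl_crmEquilibrium {a b γ r ℓ : ℝ} (ha : a < 0) (hb : 0 < b) (hγ : 0 < γ) (hℓ : ℓ < 0)
    (hr : r ≠ 0) {s : ℝ → EuclideanSpace ℝ (Fin 3) → ℝ → EuclideanSpace ℝ (Fin 3)}
    (hs : IsTransitionFunction (crmField a b γ r ℓ) s) : UASL s (crmEquilibrium a b r) := by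
  obtain ⟨B, hB, hbdd⟩ := exists_norm_sub_crmEquilibrium_le r ha hb hγ hℓ
  have hstab : ∀ t₀ : ℝ, 0 ≤ t₀ → ∀ x₀ t, t₀ ≤ t →
      ‖s t x₀ t₀ - crmEquilibrium a b r‖ ≤ B * ‖x₀ - crmEquilibrium a b r‖ := by
    intro t₀ ht₀ x₀ t ht
    have h := hbdd (fun τ => s τ x₀ t₀) (fun _ => 1) t₀ (fun _ => zero_le_one)
      (fun t ht => by
        rw [one_smul]
        exact (hs t₀ ht₀ x₀).2 t ht) t ht
    simpa only [(hs t₀ ht₀ x₀).1] using h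
  refine ⟨fun ε hε => ⟨ε / B, by positivity, fun t₀ ht₀ x₀ hx₀ t ht => ?_⟩,
    fun R _ => ⟨B * R, fun t₀ ht₀ x₀ hx₀ t ht => ?_⟩, fun ρ hρ η hη => ?_⟩
  · exact (hstab t₀ ht₀ x₀ t ht).trans ((le_div_iff₀' hB).1 hx₀)
  · exact (hstab t₀ ht₀ x₀ t ht).trans (by gcongr)
  · obtain ⟨C, κ, hC, hκ, hexp⟩ := exists_exp_bound_crmField ha hb hγ hℓ hr ρ
    -- Chosen so that the crude bound `x ≤ exp x` suffices.
    refine ⟨C * ρ ^ 2 / (η ^ 2 * κ), by positivity, fun t₀ ht₀ x₀ hx₀ t ht => ?_⟩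
    have hT : 0 ≤ C * ρ ^ 2 / (η ^ 2 * κ) := by positivity
    have hs₀ := (hs t₀ ht₀ x₀).1
    have h := hexp (fun τ => s τ x₀ t₀) t₀ (hs t₀ ht₀ x₀).2 (by simpa only [hs₀] using hx₀) t
      (by linarith)
    simp only [hs₀] at h
    have hgrow : C * ρ ^ 2 ≤ η ^ 2 * Real.exp (κ * (t - t₀)) := by
      have h1 : C * ρ ^ 2 ≤ (t - t₀) * (η ^ 2 * κ) := (div_le_iff₀ (by positivity)).1 (by linarith)
      have h2 : κ * (t - t₀) ≤ Real.exp (κ * (t - t₀)) := by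
        linarith [Real.add_one_le_exp (κ * (t - t₀))]
      have h3 := mul_le_mul_of_nonneg_left h2 (sq_nonneg η)
      linarith
    have h4 : C * ‖x₀ - crmEquilibrium a b r‖ ^ 2 ≤ C * ρ ^ 2 := by gcongr
    exact le_of_sq_le_sq (le_of_mul_le_mul_right (h.trans (h4.trans hgrow)) (Real.exp_pos _)) hη.le

end CRMStability

theorem mainTheorem8 (a b γ r ℓ : ℝ) (ha : a < 0) (hb : 0 < b) (hγ : 0 < γ) (hℓ : ℓ < 0)
    (hr : r ≠ 0) :
    (∀ p : EuclideanSpace ℝ (Fin 3),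
      CRMStability.IsEquilibrium (CRMStability.crmField a b γ r ℓ) p ↔
        p = CRMStability.crmEquilibrium a b r) ∧
    (∃ s : ℝ → EuclideanSpace ℝ (Fin 3) → ℝ → EuclideanSpace ℝ (Fin 3),
      CRMStability.IsTransitionFunction (CRMStability.crmField a b γ r ℓ) s) ∧
    (∀ s : ℝ → EuclideanSpace ℝ (Fin 3) → ℝ → EuclideanSpace ℝ (Fin 3),
      CRMStability.IsTransitionFunction (CRMStability.crmField a b γ r ℓ) s →
        CRMStability.UASL s (CRMStability.crmEquilibrium a b r)) := by
  refine ⟨CRMStability.isEquilibrium_crmField_iff ha hb hγ hℓ hr, ?_,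
    fun s hs => CRMStability.uasl_crmEquilibrium ha hb hγ hℓ hr hs⟩
  choose z hz₀ hz using CRMStability.exists_solution_crmField r ha hb hγ hℓ
  exact ⟨fun t z₀ t₀ => z t₀ z₀ t, fun t₀ _ z₀ => ⟨hz₀ t₀ z₀, hz t₀ z₀⟩⟩
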